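/- Let $B_3=\langle \sigma_1,\sigma_2 \mid \sigma_1\sigma_2\sigma_1=\sigma_2\sigma_1\sigma_2\rangle$ be the braid group on three strands and let $\beta_3:B_3\to \mathrm{GL}(3,\mathbb{Z}[t,t^{-1}])$ be the (unreduced) Burau representation, given by $$\sigma_1\mapsto\begin{pmatrix}1-t&t&0\\1&0&0\\0&0&1\end{pmatrix},\qquad \sigma_2\mapsto\begin{pmatrix}1&0&0\\0&1-t&t\\0&1&0\end{pmatrix}.$$ Put $v=(t,t^2,t^3)$, $\vec 1=(1,1,1)^T$ and $$J_3=\begin{pmatrix}1&-t^{-1}&-t^{-1}\\-t&1&-t^{-1}\\-t&-t&1\end{pmatrix},$$ and for a matrix $A$ over $\mathbb{Z}[t,t^{-1}]$ let $\overline{A}$ be the matrix obtained by substituting $t\mapsto t^{-1}$ in every entry. Salter's target group is $$\Gamma=\{A\in \mathrm{GL}(3,\mathbb{Z}[t,t^{-1}]) : vA=v,\ A\vec 1=\vec 1,\ \overline{A}J_3A^T=J_3,\ A|_{t=1}\text{ is a permutation matrix}\};$$ it contains $\beta_3(B_3)$. Let $\overline{\Gamma}$ be the quotient of $\Gamma$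 by its centre and $q:\Gamma\to\overline{\Gamma}$ the quotient map. Theorem 1.1. The map $q\circ\beta_3:B_3\to\overline{\Gamma}$ is not surjective. Moreover, $[\overline{\Gamma}:q(\beta_3(B_3))]=\infty$. -/

import Mathlib

open scoped LaurentPolynomial Matrix

/-- The defining relators of Artin's presentation of the braid group on `n` strands, on generators
`σ_0, …, σ_{n-2}` (shifted by one from the usual numbering): `σ_i σ_j σ_i = σ_j σ_i σ_j` when
`j = i + 1`, and `σ_i σ_j = σ_j σ_i` when `i + 2 ≤ j`. -/
def braidRelators (n : ℕ) : Set (FreeGroup (Fin (n - 1))) :=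
  {r | ∃ i j : Fin (n - 1), (i : ℕ) + 1 = j ∧
      r = (FreeGroup.of i * FreeGroup.of j * FreeGroup.of i) *
        (FreeGroup.of j * FreeGroup.of i * FreeGroup.of j)⁻¹} ∪
  {r | ∃ i j : Fin (n - 1), (i : ℕ) + 2 ≤ j ∧
      r = (FreeGroup.of i * FreeGroup.of j) * (FreeGroup.of j * FreeGroup.of i)⁻¹}

/-- The braid group `B_n`. -/
abbrev BraidGroup (n : ℕ) : Type := PresentedGroup (braidRelators n)

namespace Burau

/-- The variable `t` of `ℤ[t, t⁻¹]`. -/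
noncomputable abbrev t : ℤ[T;T⁻¹] := LaurentPolynomial.T 1

/-- The inverse `t⁻¹` of the variable of `ℤ[t, t⁻¹]`. -/
noncomputable abbrev tInv : ℤ[T;T⁻¹] := LaurentPolynomial.T (-1)

theorem t_mul_tInv : t * tInv = 1 := by
  rw [← LaurentPolynomial.T_add]; simp

theorem tInv_mul_t : tInv * t = 1 := by
  rw [← LaurentPolynomial.T_add]; simp

/-- The entrywise involution `A ↦ Ā` induced by `t ↦ t⁻¹`. -/
noncomputable def bar : Matrix (Fin 3) (Fin 3) ℤ[T;T⁻¹] →+* Matrix (Fin 3) (Fin 3) ℤ[T;T⁻¹] :=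
  (LaurentPolynomial.invert (R := ℤ) : ℤ[T;T⁻¹] →+* ℤ[T;T⁻¹]).mapMatrix

/-- The entrywise evaluation `A ↦ A|_{t = 1}`. -/
noncomputable def evalOne : Matrix (Fin 3) (Fin 3) ℤ[T;T⁻¹] →+* Matrix (Fin 3) (Fin 3) ℤ :=
  (LaurentPolynomial.eval₂ (RingHom.id ℤ) (1 : ℤˣ)).mapMatrix

/-- The matrix `J_3` of the sesquilinear form. -/
noncomputable def J : Matrix (Fin 3) (Fin 3) ℤ[T;T⁻¹] :=
  !![1, -tInv, -tInv; -t, 1, -tInv; -t, -t, 1]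

/-- The row vector `v = (t, t², t³)`. -/
noncomputable def v : Fin 3 → ℤ[T;T⁻¹] := ![t, t ^ 2, t ^ 3]

/-- The target group `Γ`: matrices `A ∈ GL(3, ℤ[t, t⁻¹])` with `v A = v`, `A (1,1,1)ᵀ = (1,1,1)ᵀ`,
`Ā J₃ Aᵀ = J₃`, such that `A|_{t = 1}` is a permutation matrix. -/
noncomputable def Gam : Subgroup (GL (Fin 3) ℤ[T;T⁻¹]) where
  carrier := {A | v ᵥ* A.val = v ∧ A.val *ᵥ 1 = 1 ∧ bar A.val * J * A.valᵀ = J ∧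
    ∃ s : Equiv.Perm (Fin 3), evalOne A.val = s.permMatrix ℤ}
  one_mem' := by
    refine ⟨by simp, by simp, by simp, 1, by simp⟩
  mul_mem' := by
    rintro A B ⟨a1, a2, a3, s, a4⟩ ⟨b1, b2, b3, u, b4⟩
    refine ⟨?_, ?_, ?_, u * s, ?_⟩
    · rw [Units.val_mul, ← Matrix.vecMul_vecMul, a1, b1]
    · rw [Units.val_mul, ← Matrix.mulVec_mulVec, b2, a2]
    · rw [Units.val_mul, map_mul, Matrix.transpose_mul]
      calc bar A.val * bar B.val * J * (B.valᵀ * A.valᵀ)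
          = bar A.val * (bar B.val * J * B.valᵀ) * A.valᵀ := by simp only [Matrix.mul_assoc]
        _ = J := by rw [b3, a3]
    · rw [Units.val_mul, map_mul, a4, b4, Matrix.permMatrix_mul]
  inv_mem' := by
    rintro A ⟨a1, a2, a3, s, a4⟩
    have h1 : A.val * (A⁻¹).val = 1 := A.mul_inv
    have h2 : (A⁻¹).val * A.val = 1 := A.inv_mul
    refine ⟨?_, ?_, ?_, s⁻¹, ?_⟩
    · conv_lhs => rw [← a1]
      rw [Matrix.vecMul_vecMul, h1, Matrix.vecMul_one]
    · conv_lhs => rw [← a2]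
      rw [Matrix.mulVec_mulVec, h2, Matrix.one_mulVec]
    · have h3 : bar (A⁻¹).val * bar A.val = 1 := by rw [← map_mul, h2, map_one]
      have h4 : A.valᵀ * (A⁻¹).valᵀ = 1 := by
        rw [← Matrix.transpose_mul, h2, Matrix.transpose_one]
      calc bar (A⁻¹).val * J * (A⁻¹).valᵀ
          = bar (A⁻¹).val * (bar A.val * J * A.valᵀ) * (A⁻¹).valᵀ := by rw [a3]
        _ = (bar (A⁻¹).val * bar A.val) * J * (A.valᵀ * (A⁻¹).valᵀ) := by
            simp only [Matrix.mul_assoc]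
        _ = J := by rw [h3, h4, Matrix.one_mul, Matrix.mul_one]
    · have h5 : evalOne (A⁻¹).val * evalOne A.val = 1 := by rw [← map_mul, h2, map_one]
      have h6 : s.permMatrix ℤ * (s⁻¹).permMatrix ℤ = 1 := by
        rw [← Matrix.permMatrix_mul]; simp
      rw [a4] at h5
      exact left_inv_eq_right_inv h5 h6

/-- The quotient `Γ̄` of `Γ` by its centre. -/
abbrev GamBar : Type := Gam ⧸ Subgroup.center Gam

/-- The quotient map `q : Γ → Γ̄`. -/
noncomputable def q : Gam →* GamBar := QuotientGroup.mk' (Subgroup.center Gam)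

section aux

variable {R : Type*} [CommRing R] (x y : R)

theorem aux_left0 (h : x * y = 1) :
    (!![1 - x, x, 0; 1, 0, 0; 0, 0, 1] * !![0, 1, 0; y, 1 - y, 0; 0, 0, 1] :
      Matrix (Fin 3) (Fin 3) R) = 1 := by
  refine Matrix.ext fun i j => ?_
  fin_cases i <;> fin_cases j <;> simp [Matrix.mul_apply, Fin.sum_univ_three] <;> grind

theorem aux_left1 (h : x * y = 1) :
    (!![1, 0, 0; 0, 1 - x, x; 0, 1, 0] * !![1, 0, 0; 0, 0, 1; 0, y, 1 - y] :
      Matrix (Fin 3) (Fin 3) R) = 1 := by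
  refine Matrix.ext fun i j => ?_
  fin_cases i <;> fin_cases j <;> simp [Matrix.mul_apply, Fin.sum_univ_three] <;> grind

theorem aux_form0 (h : x * y = 1) :
    (!![1 - y, y, 0; 1, 0, 0; 0, 0, 1] * !![1, -y, -y; -x, 1, -y; -x, -x, 1] *
      !![1 - x, x, 0; 1, 0, 0; 0, 0, 1]ᵀ : Matrix (Fin 3) (Fin 3) R) =
      !![1, -y, -y; -x, 1, -y; -x, -x, 1] := by
  refine Matrix.ext fun i j => ?_
  fin_cases i <;> fin_cases j <;> simp [Matrix.mul_apply, Fin.sum_univ_three] <;> grind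

theorem aux_form1 (h : x * y = 1) :
    (!![1, 0, 0; 0, 1 - y, y; 0, 1, 0] * !![1, -y, -y; -x, 1, -y; -x, -x, 1] *
      !![1, 0, 0; 0, 1 - x, x; 0, 1, 0]ᵀ : Matrix (Fin 3) (Fin 3) R) =
      !![1, -y, -y; -x, 1, -y; -x, -x, 1] := by
  refine Matrix.ext fun i j => ?_
  fin_cases i <;> fin_cases j <;> simp [Matrix.mul_apply, Fin.sum_univ_three] <;> grind

theorem aux_vec0 :
    ![x, x ^ 2, x ^ 3] ᵥ* !![1 - x, x, 0; 1, 0, 0; 0, 0, 1] = ![x, x ^ 2, x ^ 3] := by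
  funext j
  fin_cases j <;> simp [Matrix.vecMul, dotProduct, Fin.sum_univ_three] <;> ring

theorem aux_vec1 :
    ![x, x ^ 2, x ^ 3] ᵥ* !![1, 0, 0; 0, 1 - x, x; 0, 1, 0] = ![x, x ^ 2, x ^ 3] := by
  funext j
  fin_cases j <;> simp [Matrix.vecMul, dotProduct, Fin.sum_univ_three] <;> ring

theorem aux_braid :
    (!![1 - x, x, 0; 1, 0, 0; 0, 0, 1] * !![1, 0, 0; 0, 1 - x, x; 0, 1, 0] *
      !![1 - x, x, 0; 1, 0, 0; 0, 0, 1] : Matrix (Fin 3) (Fin 3) R) =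
    !![1, 0, 0; 0, 1 - x, x; 0, 1, 0] * !![1 - x, x, 0; 1, 0, 0; 0, 0, 1] *
      !![1, 0, 0; 0, 1 - x, x; 0, 1, 0] := by
  refine Matrix.ext fun i j => ?_
  fin_cases i <;> fin_cases j <;> simp [Matrix.mul_apply, Fin.sum_univ_three] <;> ring

end aux

/-- The Burau matrices of the two generators `σ_1`, `σ_2` of `B_3` (indexed by `0`, `1`), with their
inverses. -/
noncomputable def sigma : Fin 2 → GL (Fin 3) ℤ[T;T⁻¹] :=
  ![{ val := !![1 - t, t, 0; 1, 0, 0; 0, 0, 1]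
      inv := !![0, 1, 0; tInv, 1 - tInv, 0; 0, 0, 1]
      val_inv := aux_left0 t tInv t_mul_tInv
      inv_val := mul_eq_one_comm.1 (aux_left0 t tInv t_mul_tInv) },
    { val := !![1, 0, 0; 0, 1 - t, t; 0, 1, 0]
      inv := !![1, 0, 0; 0, 0, 1; 0, tInv, 1 - tInv]
      val_inv := aux_left1 t tInv t_mul_tInv
      inv_val := mul_eq_one_comm.1 (aux_left1 t tInv t_mul_tInv) }]

theorem sigma_braid : sigma 0 * sigma 1 * sigma 0 = sigma 1 * sigma 0 * sigma 1 :=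
  Units.ext (aux_braid t)

theorem lift_sigma (r : FreeGroup (Fin (3 - 1))) (hr : r ∈ braidRelators 3) :
    FreeGroup.lift sigma r = 1 := by
  rcases hr with ⟨i, j, hij, rfl⟩ | ⟨i, j, hij, rfl⟩
  · obtain rfl : i = 0 := by ext; have := j.2; simp; omega
    obtain rfl : j = 1 := by ext; simpa using hij.symm
    rw [map_mul, map_inv, mul_inv_eq_one]
    simpa using sigma_braid
  · have := j.2
    omega

/-- The (unreduced) Burau representation `β_3 : B_3 → GL(3, ℤ[t, t⁻¹])`. -/
noncomputable def beta : BraidGroup 3 →* GL (Fin 3) ℤ[T;T⁻¹] :=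
  PresentedGroup.toGroup lift_sigma

theorem bar_sigma0 : bar !![1 - t, t, 0; 1, 0, 0; 0, 0, 1] =
    !![1 - tInv, tInv, 0; 1, 0, 0; 0, 0, 1] := by
  refine Matrix.ext fun i j => ?_
  fin_cases i <;> fin_cases j <;> simp [bar]

theorem bar_sigma1 : bar !![1, 0, 0; 0, 1 - t, t; 0, 1, 0] =
    !![1, 0, 0; 0, 1 - tInv, tInv; 0, 1, 0] := by
  refine Matrix.ext fun i j => ?_
  fin_cases i <;> fin_cases j <;> simp [bar]

theorem evalOne_sigma0 : evalOne !![1 - t, t, 0; 1, 0, 0; 0, 0, 1] =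
    (Equiv.swap (0 : Fin 3) 1).permMatrix ℤ := by
  refine Matrix.ext fun i j => ?_
  fin_cases i <;> fin_cases j <;>
    simp [evalOne, Equiv.Perm.permMatrix, PEquiv.toMatrix_apply, Equiv.swap_apply_def]

theorem evalOne_sigma1 : evalOne !![1, 0, 0; 0, 1 - t, t; 0, 1, 0] =
    (Equiv.swap (1 : Fin 3) 2).permMatrix ℤ := by
  refine Matrix.ext fun i j => ?_
  fin_cases i <;> fin_cases j <;>
    simp [evalOne, Equiv.Perm.permMatrix, PEquiv.toMatrix_apply, Equiv.swap_apply_def]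

theorem sigma_mem (i : Fin 2) : sigma i ∈ Gam := by
  fin_cases i
  · refine ⟨aux_vec0 t, ?_, ?_, Equiv.swap 0 1, evalOne_sigma0⟩
    · funext j
      fin_cases j <;> simp [sigma, Matrix.mulVec, dotProduct, Fin.sum_univ_three]
    · exact (congrArg (fun M => M * J * _) bar_sigma0).trans (aux_form0 t tInv t_mul_tInv)
  · refine ⟨aux_vec1 t, ?_, ?_, Equiv.swap 1 2, evalOne_sigma1⟩
    · funext j
      fin_cases j <;> simp [sigma, Matrix.mulVec, dotProduct, Fin.sum_univ_three]
    · exact (congrArg (fun M => M * J * _) bar_sigma1).trans (aux_form1 t tInv t_mul_tInv)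

theorem beta_mem (b : BraidGroup 3) : beta b ∈ Gam := by
  induction b using PresentedGroup.induction_on with
  | _ w =>
    have : beta (PresentedGroup.mk _ w) = FreeGroup.lift sigma w := rfl
    rw [this]
    have hw : FreeGroup.lift sigma w ∈ (FreeGroup.lift sigma).range := ⟨w, rfl⟩
    rw [FreeGroup.range_lift_eq_closure] at hw
    refine (Subgroup.closure_le Gam).2 ?_ hw
    rintro _ ⟨i, rfl⟩
    exact sigma_mem i

/-- The Burau representation with codomain `Γ`. -/
noncomputable def betaGam : BraidGroup 3 →* Gam := beta.codRestrict Gam beta_mem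

end Burau

/-!
The group `Γ` contains an element `γ` (`exoticUnit`) no positive power of which lies in
`β₃(B₃) · Z(Γ)`; the cosets of the classes of `1, γ, γ², …` are then pairwise distinct, which gives
both assertions.

All matrices `A` involved satisfy `A 𝟙 = 𝟙`, so they act on the right on the rank two module of rows
with coordinate sum zero, with basis `f₁ = e₁ - e₂`, `f₂ = t (e₂ - e₃)`. In this basis
`σ₁ = -W² D` and `σ₂ = -D W²` with `W = !![-1, -1; 1, 0]` of order three and `D = !![0, 1; t, 0]`,
`D² = t`. Up to scalars, `B₃` therefore acts through alternating words in `W^{±1}` and `D`; over `ℚ`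
one has in addition the letters `x + y W`, which are similitudes of the same Hermitian form.
The element `γ` comes from a word in such letters that happens to be integral: it is `t⁻⁴` times the
product of the letters `x + y W` for
`(x, y) = (2,1), (2,3), (2,7), (9,13), (8,19), (5,21), (11,19), (9,13), (5,7), (2,3), (2,1)`,
separated by `D`, and divided by the product of all the `y`. Here the norm `x² - xy + y²` of each
letter is the product of the two neighbouring values of `y` (with `1` beyond either end), so that the
quotient has determinant a power of `t`. It is the identity at `t = 1`. That `γ` lies in `Γ` is
checked directly from its entries (`det_exotic`, `exotic_unitary`, `exotic_one_one`).

To separate `γⁿ` from `β₃(B₃)`, specialise `t` to the large number `1000` and play ping-pong on rows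
`p f₁ + q f₂`, up to scaling. The orbit of `3 f₁ + f₂` under `B₃` stays in the region
`|p| ≤ 2 |p + q|` (`Reach.bound`, `exists_orb_beta`), because `D` contracts towards the direction
`(1, 0)`, and `W`, `W²` move this direction to `(1, 1)` and `(0, 1)`. But `γ` contracts towards
`(1, -1)`, so every `γⁿ` with `n ≥ 1` sends `3 f₁ + f₂` into `10 |p + q| ≤ p` (`kerRow_exotic_pow`).
A central element of `Γ` acts on these rows by a nonzero scalar (`kerRow_center`) and does not help.
-/

/-! ### The exotic matrix over a commutative ring -/

namespace Burau

section Generic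

variable {R : Type*} [CommRing R]

/-- A matrix whose columns are annihilated on the left by the row `(x, x², x³)`. -/
def kerCols (x : R) : Matrix (Fin 3) (Fin 2) R := !![x, 0; -1, x; 0, -1]

/-- The matrix with rows `f₁ = e₁ - e₂` and `f₂ = x (e₂ - e₃)`, a basis (for `x` a unit) of the rows
with coordinate sum zero. -/
def redBasis (x : R) : Matrix (Fin 2) (Fin 3) R := !![1, -1, 0; 0, x, -x]

/-- Up to a power of `x⁻¹`, the `(1, 1)` entry of `exoticBlock`; similarly for the other three
`blockPoly`s. -/
def blockPoly11 (x : R) : R :=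
  2 - 4 * x + 4 * x ^ 2 - x ^ 3 - 5 * x ^ 4 + 8 * x ^ 5 - 8 * x ^ 6 + 6 * x ^ 7 - 3 * x ^ 8 + x ^ 9

def blockPoly12 (x : R) : R :=
  4 - 12 * x + 22 * x ^ 2 - 30 * x ^ 3 + 31 * x ^ 4 - 26 * x ^ 5 + 18 * x ^ 6 - 10 * x ^ 7 + 4 * x ^ 8 - x ^ 9

def blockPoly21 (x : R) : R :=
  1 - x + 2 * x ^ 3 - 3 * x ^ 4 + x ^ 5 + x ^ 6 - 2 * x ^ 7 + 2 * x ^ 8 - x ^ 9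

def blockPoly22 (x : R) : R :=
  2 - 4 * x + 5 * x ^ 2 - 3 * x ^ 3 - 2 * x ^ 4 + 5 * x ^ 5 - 6 * x ^ 6 + 5 * x ^ 7 - 3 * x ^ 8 + x ^ 9

/-- The reciprocal polynomial `x⁹ blockPoly11 x⁻¹`; similarly for the other three `blockRev`s. -/
def blockRev11 (x : R) : R :=
  1 - 3 * x + 6 * x ^ 2 - 8 * x ^ 3 + 8 * x ^ 4 - 5 * x ^ 5 - x ^ 6 + 4 * x ^ 7 - 4 * x ^ 8 + 2 * x ^ 9

def blockRev12 (x : R) : R :=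
  - 1 + 4 * x - 10 * x ^ 2 + 18 * x ^ 3 - 26 * x ^ 4 + 31 * x ^ 5 - 30 * x ^ 6 + 22 * x ^ 7 - 12 * x ^ 8 + 4 * x ^ 9

def blockRev21 (x : R) : R :=
  - 1 + 2 * x - 2 * x ^ 2 + x ^ 3 + x ^ 4 - 3 * x ^ 5 + 2 * x ^ 6 - x ^ 8 + x ^ 9

def blockRev22 (x : R) : R :=
  1 - 3 * x + 5 * x ^ 2 - 6 * x ^ 3 + 5 * x ^ 4 - 2 * x ^ 5 - 3 * x ^ 6 + 5 * x ^ 7 - 4 * x ^ 8 + 2 * x ^ 9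

/-- The middle factor of `exotic x y - 1`. It equals `K⁻¹ (A - 1)`, where `A` is the matrix of the
exotic element in the basis `f₁, f₂` and `K = redBasis x * kerCols x`; the argument `y` stands for
`x⁻¹`. -/
def exoticBlock (x y : R) : Matrix (Fin 2) (Fin 2) R :=
  !![y ^ 4 * blockPoly11 x, y ^ 4 * blockPoly12 x; y ^ 5 * blockPoly21 x, y ^ 5 * blockPoly22 x]

/-- The exotic element at `t = x`, `t⁻¹ = y`. The shape `1 + kerCols x * _ * redBasis x` is that of a
general matrix fixing the row `(x, x², x³)` and the column of ones. -/
def exotic (x y : R) : Matrix (Fin 3) (Fin 3) R :=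
  1 + kerCols x * exoticBlock x y * redBasis x

/-- The matrix `J₃` with `t = x` and `t⁻¹ = y`. -/
def herm (x y : R) : Matrix (Fin 3) (Fin 3) R := !![1, -y, -y; -x, 1, -y; -x, -x, 1]

theorem map_exotic {S : Type*} [CommRing S] (f : R →+* S) (x y : R) :
    f.mapMatrix (exotic x y) = exotic (f x) (f y) := by
  have h1 : (kerCols x).map f = kerCols (f x) := by
    ext i j; fin_cases i <;> fin_cases j <;> simp [kerCols]
  have h2 : (redBasis x).map f = redBasis (f x) := by
    ext i j; fin_cases i <;> fin_cases j <;> simp [redBasis]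
  have h3 : (exoticBlock x y).map f = exoticBlock (f x) (f y) := by
    ext i j; fin_cases i <;> fin_cases j <;>
      simp [exoticBlock, blockPoly11, blockPoly12, blockPoly21, blockPoly22, map_ofNat f]
  rw [exotic, map_add, map_one, RingHom.mapMatrix_apply, Matrix.map_mul, Matrix.map_mul, h1, h2, h3,
    exotic]

theorem redBasis_mul_kerCols (x : R) :
    redBasis x * kerCols x = !![1 + x, -x; -x, x + x ^ 2] := by
  ext i j
  fin_cases i <;> fin_cases j <;>
    simp [redBasis, kerCols, Matrix.mul_apply, Fin.sum_univ_three] <;> ring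

theorem exotic_mulVec_one (x y : R) : exotic x y *ᵥ 1 = 1 := by
  have h : redBasis x *ᵥ 1 = 0 := by
    funext i; fin_cases i <;> simp [redBasis, Matrix.mulVec, dotProduct, Fin.sum_univ_three]
  rw [exotic, Matrix.add_mulVec, Matrix.one_mulVec, ← Matrix.mulVec_mulVec, h, Matrix.mulVec_zero,
    add_zero]

theorem vecMul_exotic (x y : R) : ![x, x ^ 2, x ^ 3] ᵥ* exotic x y = ![x, x ^ 2, x ^ 3] := by
  have h : ![x, x ^ 2, x ^ 3] ᵥ* kerCols x = 0 := by
    funext i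
    fin_cases i <;> simp [kerCols, Matrix.vecMul, dotProduct, Fin.sum_univ_three] <;> ring
  rw [exotic, Matrix.vecMul_add, Matrix.vecMul_one, Matrix.mul_assoc, ← Matrix.vecMul_vecMul, h,
    Matrix.zero_vecMul, add_zero]

theorem exotic_one_one : exotic (1 : R) 1 = 1 := by
  have h : exoticBlock (1 : R) 1 = 0 := by
    ext i j; fin_cases i <;> fin_cases j <;> simp [exoticBlock, blockPoly11, blockPoly12, blockPoly21, blockPoly22] <;> ring
  rw [exotic, h, Matrix.mul_zero, Matrix.zero_mul, add_zero]

theorem det_exotic {x y : R} (h : x * y = 1) : (exotic x y).det = x ^ 2 := by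
  have key : x ^ 4 * (blockPoly11 x * (1 + x) - blockPoly12 x * x - blockPoly21 x + blockPoly22 x * (1 + x)) +
      (blockPoly11 x * blockPoly22 x - blockPoly12 x * blockPoly21 x) * (1 + x + x ^ 2) = x ^ 10 - x ^ 8 := by
    unfold blockPoly11 blockPoly12 blockPoly21 blockPoly22; ring
  have h2 : x ^ 4 * y ^ 4 = 1 := by rw [← mul_pow, h, one_pow]
  have h8 : x ^ 8 * y ^ 8 = 1 := by rw [← mul_pow, h, one_pow]
  rw [exotic, Matrix.mul_assoc, Matrix.det_one_add_mul_comm, Matrix.mul_assoc,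
    redBasis_mul_kerCols, Matrix.det_fin_two]
  simp only [exoticBlock, Matrix.add_apply, Matrix.mul_apply, Fin.sum_univ_two, Matrix.of_apply,
    Matrix.cons_val', Matrix.cons_val_zero, Matrix.cons_val_one, Matrix.one_apply_eq, ne_eq,
    zero_ne_one, one_ne_zero, not_false_eq_true, Matrix.one_apply_ne, Matrix.cons_val_fin_one]
  linear_combination y ^ 8 * key - y ^ 4 * (blockPoly11 x * (1 + x) - blockPoly12 x * x - blockPoly21 x +
      blockPoly22 x * (1 + x)) * h2 + (y ^ 4 * (-blockPoly21 x + blockPoly22 x + blockPoly22 x * x) +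
      y ^ 8 * (blockPoly11 x * blockPoly22 x - blockPoly12 x * blockPoly21 x) * (1 + x + x ^ 2)) * h + (x ^ 2 - 1) * h8

theorem herm_mul_redBasis_transpose {x y : R} (h : x * y = 1) :
    herm x y * (redBasis x)ᵀ = kerCols y * !![1 + x, 0; 0, x * (1 + x)] := by
  ext i j
  fin_cases i <;> fin_cases j <;>
    simp [herm, redBasis, kerCols, Matrix.mul_apply, Fin.sum_univ_three] <;> grind

theorem redBasis_mul_herm {x y : R} (h : x * y = 1) :
    redBasis y * herm x y = !![1 + y, 0; 0, y * (1 + y)] * (kerCols x)ᵀ := by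
  ext i j
  fin_cases i <;> fin_cases j <;>
    simp [herm, redBasis, kerCols, Matrix.mul_apply, Fin.sum_univ_three] <;> grind

theorem pow_mul_pow_of_mul_eq_one {x y : R} (h : x * y = 1) (k : ℕ) : x ^ k * y ^ k = 1 := by
  rw [← mul_pow, h, one_pow]

theorem blockPoly_reverse {x y : R} (h : x * y = 1) :
    blockPoly11 y = y ^ 9 * blockRev11 x ∧ blockPoly12 y = y ^ 9 * blockRev12 x ∧ blockPoly21 y = y ^ 9 * blockRev21 x ∧
      blockPoly22 y = y ^ 9 * blockRev22 x := by
  have e (k : ℕ) := pow_mul_pow_of_mul_eq_one h k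
  have e1 : y ^ 9 * x = y ^ 8 := by linear_combination y ^ 8 * h
  have e2 : y ^ 9 * x ^ 2 = y ^ 7 := by linear_combination y ^ 7 * e 2
  have e3 : y ^ 9 * x ^ 3 = y ^ 6 := by linear_combination y ^ 6 * e 3
  have e4 : y ^ 9 * x ^ 4 = y ^ 5 := by linear_combination y ^ 5 * e 4
  have e5 : y ^ 9 * x ^ 5 = y ^ 4 := by linear_combination y ^ 4 * e 5
  have e6 : y ^ 9 * x ^ 6 = y ^ 3 := by linear_combination y ^ 3 * e 6
  have e7 : y ^ 9 * x ^ 7 = y ^ 2 := by linear_combination y ^ 2 * e 7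
  have e8 : y ^ 9 * x ^ 8 = y := by linear_combination y * e 8
  have e9 : y ^ 9 * x ^ 9 = 1 := by linear_combination e 9
  simp only [blockPoly11, blockPoly12, blockPoly21, blockPoly22, blockRev11, blockRev12, blockRev21, blockRev22, mul_add, mul_sub, mul_left_comm (y ^ 9), e1,
    e2, e3, e4, e5, e6, e7, e8, e9]
  refine ⟨?_, ?_, ?_, ?_⟩ <;> ring

/-- Unitarity of the exotic matrix, expressed through its middle factor: replacing `x` by `x⁻¹` is the
bar involution, and up to powers of `y` each entry is one polynomial identity in `x`. -/
theorem exoticBlock_unitary {x y : R} (h : x * y = 1) :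
    exoticBlock y x * !![1 + y, 0; 0, y * (1 + y)] +
      !![1 + x, 0; 0, x * (1 + x)] * (exoticBlock x y)ᵀ +
      exoticBlock y x * !![1 + y, -y; -y, y + y ^ 2] * !![1 + x, 0; 0, x * (1 + x)] *
        (exoticBlock x y)ᵀ = 0 := by
  obtain ⟨h11, h12, h21, h22⟩ := blockPoly_reverse h
  have k11 : x ^ 4 * blockRev11 x + x ^ 6 * blockPoly11 x + (blockRev11 x * (1 + x) - blockRev12 x) * blockPoly11 x +
      (-x * blockRev11 x + blockRev12 x * (1 + x)) * blockPoly12 x = 0 := by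
    unfold blockPoly11 blockPoly12 blockRev11 blockRev12; ring
  have k12 : x ^ 4 * blockRev12 x + x ^ 6 * blockPoly21 x + (blockRev11 x * (1 + x) - blockRev12 x) * blockPoly21 x +
      (-x * blockRev11 x + blockRev12 x * (1 + x)) * blockPoly22 x = 0 := by
    unfold blockPoly21 blockPoly22 blockRev11 blockRev12; ring
  have k21 : x ^ 4 * blockRev21 x + x ^ 6 * blockPoly12 x + (blockRev21 x * (1 + x) - blockRev22 x) * blockPoly11 x +
      (-x * blockRev21 x + blockRev22 x * (1 + x)) * blockPoly12 x = 0 := by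
    unfold blockPoly11 blockPoly12 blockRev21 blockRev22; ring
  have k22 : x ^ 4 * blockRev22 x + x ^ 6 * blockPoly22 x + (blockRev21 x * (1 + x) - blockRev22 x) * blockPoly21 x +
      (-x * blockRev21 x + blockRev22 x * (1 + x)) * blockPoly22 x = 0 := by
    unfold blockPoly21 blockPoly22 blockRev21 blockRev22; ring
  have ht : (exoticBlock x y)ᵀ =
      !![y ^ 4 * blockPoly11 x, y ^ 5 * blockPoly21 x; y ^ 4 * blockPoly12 x, y ^ 5 * blockPoly22 x] := by
    ext i j; fin_cases i <;> fin_cases j <;> simp [exoticBlock]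
  rw [ht, exoticBlock, h11, h12, h21, h22]
  clear h11 h12 h21 h22 ht
  simp only [Matrix.mul_fin_two]
  generalize blockPoly11 x = a at *
  generalize blockPoly12 x = b at *
  generalize blockPoly21 x = c at *
  generalize blockPoly22 x = d at *
  generalize blockRev11 x = a' at *
  generalize blockRev12 x = b' at *
  generalize blockRev21 x = c' at *
  generalize blockRev22 x = d' at *
  ext i j
  fin_cases i <;> fin_cases j <;> simp
  · clear k12 k21 k22
    grind
  · clear k11 k21 k22
    grind
  · clear k11 k12 k22
    grind
  · clear k11 k12 k21
    grind

theorem exotic_unitary {x y : R} (h : x * y = 1) :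
    exotic y x * herm x y * (exotic x y)ᵀ = herm x y := by
  have hU := exoticBlock_unitary h
  rw [← redBasis_mul_kerCols y] at hU
  have h1 := herm_mul_redBasis_transpose h
  have h2 := redBasis_mul_herm h
  set G := !![1 + x, 0; 0, x * (1 + x)]
  set G' := !![1 + y, 0; 0, y * (1 + y)]
  have e : exotic y x * herm x y * (exotic x y)ᵀ = herm x y + kerCols y * (exoticBlock y x *
      (redBasis y * herm x y)) + (herm x y * (redBasis x)ᵀ) * (exoticBlock x y)ᵀ * (kerCols x)ᵀ +
      kerCols y * exoticBlock y x * redBasis y * (herm x y * (redBasis x)ᵀ) * (exoticBlock x y)ᵀ *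
        (kerCols x)ᵀ := by
    simp only [exotic, Matrix.transpose_add, Matrix.transpose_mul, Matrix.transpose_one,
      Matrix.mul_assoc, Matrix.add_mul, Matrix.mul_add, Matrix.one_mul, Matrix.mul_one]
    abel
  have e2 : exotic y x * herm x y * (exotic x y)ᵀ = herm x y + kerCols y * (exoticBlock y x * G' +
      G * (exoticBlock x y)ᵀ + exoticBlock y x * (redBasis y * kerCols y) * G *
        (exoticBlock x y)ᵀ) * (kerCols x)ᵀ := by
    rw [e, h1, h2]
    simp only [Matrix.mul_assoc, Matrix.add_mul, Matrix.mul_add]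
    abel
  rw [e2, hU, Matrix.mul_zero, Matrix.zero_mul, add_zero]

end Generic

/-! ### The exotic element of `Γ` -/

/-- The exotic element as an invertible matrix over `ℤ[t, t⁻¹]`. -/
noncomputable def exoticUnit : GL (Fin 3) ℤ[T;T⁻¹] :=
  Matrix.nonsingInvUnit (exotic t tInv) (by
    rw [det_exotic t_mul_tInv]
    exact (IsUnit.of_mul_eq_one tInv t_mul_tInv).pow 2)

theorem exoticUnit_val : exoticUnit.val = exotic t tInv := rfl

theorem exoticUnit_mem : exoticUnit ∈ Gam := by
  refine ⟨?_, ?_, ?_, 1, ?_⟩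
  · exact vecMul_exotic t tInv
  · exact exotic_mulVec_one t tInv
  · have hbar : bar exoticUnit.val = exotic tInv t := by
      rw [exoticUnit_val, bar, map_exotic]
      simp
    rw [hbar]
    exact exotic_unitary t_mul_tInv
  · have h : evalOne exoticUnit.val = exotic 1 1 := by
      rw [exoticUnit_val, evalOne, map_exotic]
      simp
    rw [h, exotic_one_one]
    simp

/-- The exotic element as an element of `Γ`. -/
noncomputable def exoticGam : Gam := ⟨exoticUnit, exoticUnit_mem⟩

/-! ### Specialisation at `t = 1000` -/

/-- The value `1000` given to `t`. Any sufficiently large number would do. -/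
noncomputable def thousand : ℚˣ := Units.mk0 1000 (by norm_num)

/-- Specialisation of matrices at `t = 1000`. -/
noncomputable def spec : GL (Fin 3) ℤ[T;T⁻¹] →* GL (Fin 3) ℚ :=
  Matrix.GeneralLinearGroup.map (LaurentPolynomial.eval₂ (Int.castRingHom ℚ) thousand)

/-- The row `p f₁ + q f₂` at `t = 1000`. -/
def kerRow (p q : ℚ) : Fin 3 → ℚ := ![p, 1000 * q - p, -1000 * q]

theorem kerRow_inj {p q p' q' : ℚ} (h : kerRow p q = kerRow p' q') : p = p' ∧ q = q' := by
  have h0 := congrFun h 0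
  have h2 := congrFun h 2
  simp [kerRow] at h0 h2
  exact ⟨h0, h2⟩

theorem kerRow_smul (c p q : ℚ) : kerRow (c * p) (c * q) = c • kerRow p q := by
  funext i; fin_cases i <;> simp [kerRow] <;> ring

theorem kerRow_add (p q p' q' : ℚ) : kerRow (p + p') (q + q') = kerRow p q + kerRow p' q' := by
  funext i; fin_cases i <;> simp [kerRow] <;> ring

theorem kerRow_sigma0 (p q : ℚ) :
    kerRow p q ᵥ* (spec (sigma 0)).val = kerRow (1000 * (q - p)) q := by
  funext i
  fin_cases i <;>
    simp [kerRow, spec, sigma, thousand, Matrix.vecMul, dotProduct, Fin.sum_univ_three] <;> ring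

theorem kerRow_sigma1 (p q : ℚ) :
    kerRow p q ᵥ* (spec (sigma 1)).val = kerRow p (p - 1000 * q) := by
  funext i
  fin_cases i <;>
    simp [kerRow, spec, sigma, thousand, Matrix.vecMul, dotProduct, Fin.sum_univ_three] <;> ring

theorem vecMul_inv_of_eq {x y : Fin 3 → ℚ} {A : GL (Fin 3) ℚ} (h : x ᵥ* A.val = y) :
    y ᵥ* (A⁻¹).val = x := by
  rw [← h, Matrix.vecMul_vecMul, ← Units.val_mul, mul_inv_cancel, Units.val_one, Matrix.vecMul_one]

/-! ### Ping-pong for the braid group -/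

/-- The rows `(p, q)` obtained from `(3, 1)` by reduced words in `W` and `D`. The flag records which
letter may follow: `Reach true` holds for the start and its images under `W`, `W²`, and for rows
whose last letter is `W` or `W²`; `Reach false` holds for rows whose last letter is `D`. -/
inductive Reach : Bool → ℚ → ℚ → Prop
  | base0 : Reach true 3 1
  | base1 : Reach true (-2) (-3)
  | base2 : Reach true (-1) 2
  | flip {p q : ℚ} : Reach true p q → Reach false (1000 * q) p
  | rot {p q : ℚ} : Reach false p q → Reach true (q - p) (-p)
  | rotInv {p q : ℚ} : Reach false p q → Reach true (-q) (p - q)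

/-- The ping-pong estimate: `D` brings a row close to the direction `(1, 0)`, from where `W` and `W²`
bring it close to `(1, 1)` and `(0, 1)`. -/
theorem Reach.bound {b : Bool} {p q : ℚ} (h : Reach b p q) :
    |p| ≤ 2 * |p + q| ∧ (if b then |p| ≤ 3 * |q| else 300 * |q| ≤ |p|) := by
  induction h with
  | base0 => norm_num [abs_of_pos, abs_of_neg]
  | base1 => norm_num [abs_of_pos, abs_of_neg]
  | base2 => norm_num [abs_of_pos, abs_of_neg]
  | @flip p q _ ih =>
    have h1 : |1000 * q| = 1000 * |q| := by rw [abs_mul]; norm_num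
    have h2 := abs_sub_abs_le_abs_sub (1000 * q) (-p)
    rw [abs_neg, sub_neg_eq_add] at h2
    have h3 := ih.2
    have h4 := abs_nonneg q
    simp only [if_true, Bool.false_eq_true, if_false] at *
    constructor <;> linarith
  | @rot p q _ ih =>
    have h1 := abs_sub p q
    have h3 := ih.2
    have h4 := abs_sub_abs_le_abs_sub (2 * p) q
    have h5 : |2 * p| = 2 * |p| := by rw [abs_mul]; norm_num
    have h6 : |q - p + -p| = |2 * p - q| := by rw [← abs_neg]; congr 1; ring
    rw [h6, abs_neg, abs_sub_comm q p]
    have h7 := abs_nonneg p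
    simp only [if_true, Bool.false_eq_true, if_false] at *
    constructor <;> linarith
  | @rotInv p q _ ih =>
    have h3 := ih.2
    have h4 := abs_sub_abs_le_abs_sub p q
    have h5 := abs_sub_abs_le_abs_sub p (2 * q)
    have h6 : |2 * q| = 2 * |q| := by rw [abs_mul]; norm_num
    have h7 : -q + (p - q) = p - 2 * q := by ring
    rw [h7, abs_neg]
    have h8 := abs_nonneg q
    simp only [if_true, Bool.false_eq_true, if_false] at *
    constructor <;> linarith

/-- The rows proportional to one in `Reach`. This set is stable under `W`, `D` and scalars. -/
def Orb (p q : ℚ) : Prop := ∃ (c : ℚ) (b : Bool) (p' q' : ℚ), Reach b p' q' ∧ p = c * p' ∧ q = c * q'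

theorem Orb.smul {p q : ℚ} (h : Orb p q) (c : ℚ) : Orb (c * p) (c * q) := by
  obtain ⟨d, b, p', q', h, rfl, rfl⟩ := h
  exact ⟨c * d, b, p', q', h, by ring, by ring⟩

theorem Orb.bound {p q : ℚ} (h : Orb p q) : |p| ≤ 2 * |p + q| := by
  obtain ⟨c, b, p', q', h, rfl, rfl⟩ := h
  rw [← mul_add, abs_mul, abs_mul]
  have := mul_le_mul_of_nonneg_left h.bound.1 (abs_nonneg c)
  linarith

theorem Orb.flip {p q : ℚ} (h : Orb p q) : Orb (1000 * q) p := by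
  obtain ⟨c, b, p', q', h, rfl, rfl⟩ := h
  cases h with
  | base0 => exact ⟨c, _, _, _, .flip .base0, by ring, by ring⟩
  | base1 => exact ⟨c, _, _, _, .flip .base1, by ring, by ring⟩
  | base2 => exact ⟨c, _, _, _, .flip .base2, by ring, by ring⟩
  -- `D² = t`
  | flip h => exact ⟨1000 * c, _, _, _, h, by ring, by ring⟩
  | rot h => exact ⟨c, _, _, _, .flip (.rot h), by ring, by ring⟩
  | rotInv h => exact ⟨c, _, _, _, .flip (.rotInv h), by ring, by ring⟩

theorem Orb.rot {p q : ℚ} (h : Orb p q) : Orb (q - p) (-p) := by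
  obtain ⟨c, b, p', q', h, rfl, rfl⟩ := h
  cases h with
  | base0 => exact ⟨c, _, _, _, .base1, by ring, by ring⟩
  | base1 => exact ⟨c, _, _, _, .base2, by ring, by ring⟩
  | base2 => exact ⟨c, _, _, _, .base0, by ring, by ring⟩
  | flip h => exact ⟨c, _, _, _, .rot (.flip h), by ring, by ring⟩
  | rot h => exact ⟨c, _, _, _, .rotInv h, by ring, by ring⟩
  | rotInv h => exact ⟨c, _, _, _, h, by ring, by ring⟩

theorem Orb.sigma0 {p q : ℚ} (h : Orb p q) : Orb (1000 * (q - p)) q := by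
  convert (h.rot.rot.flip.smul (-1)) using 1 <;> ring

theorem Orb.sigma1 {p q : ℚ} (h : Orb p q) : Orb p (p - 1000 * q) := by
  convert (h.flip.rot.rot.smul (-1)) using 1 <;> ring

theorem Orb.sigma0_inv {p q : ℚ} (h : Orb p q) : Orb (q - p / 1000) q := by
  convert (h.flip.rot.smul (-1 / 1000)) using 1 <;> ring

theorem Orb.sigma1_inv {p q : ℚ} (h : Orb p q) : Orb p ((p - q) / 1000) := by
  convert (h.rot.flip.smul (-1 / 1000)) using 1 <;> ring

theorem exists_orb_lift (w : FreeGroup (Fin 2)) (p q : ℚ) (h : Orb p q) :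
    ∃ p' q', Orb p' q' ∧ kerRow p q ᵥ* (spec (FreeGroup.lift sigma w)).val = kerRow p' q' := by
  induction w using FreeGroup.induction_on generalizing p q with
  | C1 => exact ⟨p, q, h, by simp⟩
  | of i =>
    rw [FreeGroup.lift_apply_of]
    fin_cases i
    · exact ⟨_, _, h.sigma0, kerRow_sigma0 p q⟩
    · exact ⟨_, _, h.sigma1, kerRow_sigma1 p q⟩
  | inv_of i _ =>
    rw [map_inv, map_inv, FreeGroup.lift_apply_of]
    fin_cases i
    · refine ⟨_, _, h.sigma0_inv, vecMul_inv_of_eq ((kerRow_sigma0 _ _).trans ?_)⟩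
      congr 1; ring
    · refine ⟨_, _, h.sigma1_inv, vecMul_inv_of_eq ((kerRow_sigma1 _ _).trans ?_)⟩
      congr 1; ring
  | mul x y hx hy =>
    obtain ⟨p1, q1, h1, e1⟩ := hx p q h
    obtain ⟨p2, q2, h2, e2⟩ := hy p1 q1 h1
    exact ⟨p2, q2, h2, by
      rw [map_mul, map_mul, Units.val_mul, ← Matrix.vecMul_vecMul, e1, e2]⟩

theorem exists_orb_beta (b : BraidGroup 3) :
    ∃ p q, Orb p q ∧ kerRow 3 1 ᵥ* (spec (beta b)).val = kerRow p q := by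
  induction b using PresentedGroup.induction_on with
  | _ w =>
    exact exists_orb_lift w 3 1 ⟨1, _, _, _, .base0, by norm_num, by norm_num⟩

/-! ### Powers of the exotic element and the centre -/

/-- The exotic element contracts towards the direction `(1, -1)`: it maps a neighbourhood of this
direction, and the starting row `(3, 1)`, into this neighbourhood. -/
theorem kerRow_exotic (p q : ℚ) : ∃ p' q', kerRow p q ᵥ* (spec exoticUnit).val = kerRow p' q' ∧
    (1 ≤ p → 10 * |p + q| ≤ p ∨ (p = 3 ∧ q = 1) → 1 ≤ p' ∧ 10 * |p' + q'| ≤ p') := by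
  have hv : (spec exoticUnit).val = exotic 1000 (1 / 1000) := by
    change (RingHom.mapMatrix _) (exotic t tInv) = _
    rw [map_exotic]
    simp [thousand]
  have he (p q : ℚ) : kerRow p q = ![p, q] ᵥ* redBasis 1000 := by
    funext i
    fin_cases i <;> simp [kerRow, redBasis, Matrix.vecMul, dotProduct] <;> ring
  set M : Matrix (Fin 2) (Fin 2) ℚ := 1 + redBasis (1000 : ℚ) * kerCols (1000 : ℚ) *
      exoticBlock 1000 (1 / 1000) with hM
  refine ⟨p * M 0 0 + q * M 1 0, p * M 0 1 + q * M 1 1, ?_, ?_⟩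
  · have hm : ![p * M 0 0 + q * M 1 0, p * M 0 1 + q * M 1 1] = ![p, q] ᵥ* M := by
      funext i
      fin_cases i <;> simp [Matrix.vecMul, dotProduct]
    rw [hv, he, he, hm, hM, exotic]
    simp only [Matrix.vecMul_add, Matrix.add_vecMul, Matrix.vecMul_one, Matrix.vecMul_vecMul,
      Matrix.mul_assoc]
  · rw [redBasis_mul_kerCols] at hM
    have h00 : M 0 0 = 999000999999001998000999999001 / 1000000000000 := by
      rw [hM]
      norm_num [exoticBlock, blockPoly11, blockPoly12, blockPoly21, blockPoly22, Matrix.mul_apply, Fin.sum_univ_two]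
    have h01 : M 0 1 = -499001498500999998502497501999 / 500000000000 := by
      rw [hM]
      norm_num [exoticBlock, blockPoly11, blockPoly12, blockPoly21, blockPoly22, Matrix.mul_apply, Fin.sum_univ_two]
    have h10 : M 1 0 = -1996005993005997000001997001999 / 1000000000000 := by
      rw [hM]
      norm_num [exoticBlock, blockPoly11, blockPoly12, blockPoly21, blockPoly22, Matrix.mul_apply, Fin.sum_univ_two]
    have h11 : M 1 1 = 997005990512486012990006497001 / 500000000000 := by
      rw [hM]
      norm_num [exoticBlock, blockPoly11, blockPoly12, blockPoly21, blockPoly22, Matrix.mul_apply, Fin.sum_univ_two]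
    -- All products are now linear in `p` and `q`.
    rw [h00, h01, h10, h11]
    rintro hp (h | ⟨rfl, rfl⟩)
    · obtain ⟨ha, hb⟩ := abs_le.1 ((le_div_iff₀' (by norm_num : (0 : ℚ) < 10)).2 h)
      refine ⟨by linarith, ?_⟩
      rw [← le_div_iff₀' (by norm_num), abs_le]
      constructor <;> linarith
    · norm_num [abs_of_pos, abs_of_neg]

theorem kerRow_exotic_pow (n : ℕ) :
    ∃ p q, kerRow 3 1 ᵥ* (spec (exoticUnit ^ (n + 1))).val = kerRow p q ∧ 1 ≤ p ∧ 10 * |p + q| ≤ p := by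
  induction n with
  | zero =>
    obtain ⟨p, q, h, h'⟩ := kerRow_exotic 3 1
    exact ⟨p, q, by simpa using h, h' (by norm_num) (Or.inr ⟨rfl, rfl⟩)⟩
  | succ n ih =>
    obtain ⟨p, q, h, h1, h2⟩ := ih
    obtain ⟨p', q', h', h''⟩ := kerRow_exotic p q
    refine ⟨p', q', ?_, h'' h1 (Or.inl h2)⟩
    rw [pow_succ, map_mul, Units.val_mul, ← Matrix.vecMul_vecMul, h, h']

theorem exists_kerRow_of_mem (A : Gam) (p q : ℚ) :
    ∃ p' q', kerRow p q ᵥ* (spec A.1).val = kerRow p' q' := by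
  have h1 : (spec A.1).val *ᵥ 1 = 1 := by
    have h := congrArg (fun x i => LaurentPolynomial.eval₂ (Int.castRingHom ℚ) thousand (x i))
      A.2.2.1
    funext i
    have hi := congrFun h i
    simp only [RingHom.map_mulVec] at hi
    convert hi using 1
    · congr 1
      funext j
      simp
    · simp
  have h2 : kerRow p q ᵥ* (spec A.1).val ⬝ᵥ 1 = 0 := by
    rw [← Matrix.dotProduct_mulVec, h1]
    simp [kerRow, dotProduct, Fin.sum_univ_three]
  generalize kerRow p q ᵥ* (spec A.1).val = x at h2
  refine ⟨x 0, -x 2 / 1000, ?_⟩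
  simp only [dotProduct, Fin.sum_univ_three, Pi.one_apply, mul_one] at h2
  funext i
  fin_cases i
  · simp [kerRow]
  · simp [kerRow]; linarith
  · simp [kerRow]; ring

/-- By Schur's lemma, central elements of `Γ` act by scalars on the rows with coordinate sum zero. -/
theorem kerRow_center {z : Gam} (hz : z ∈ Subgroup.center Gam) :
    ∃ c : ℚ, c ≠ 0 ∧ ∀ p q, kerRow p q ᵥ* (spec z.1).val = c • kerRow p q := by
  have hcomm (i : Fin 2) (x : Fin 3 → ℚ) : x ᵥ* (spec (sigma i)).val ᵥ* (spec z.1).val =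
      x ᵥ* (spec z.1).val ᵥ* (spec (sigma i)).val := by
    have h := congrArg Subtype.val (Subgroup.mem_center_iff.1 hz ⟨sigma i, sigma_mem i⟩)
    have h' := congrArg (fun A => (spec A).val) h
    simp only [Subgroup.coe_mul, map_mul, Units.val_mul] at h'
    rw [Matrix.vecMul_vecMul, Matrix.vecMul_vecMul, h']
  obtain ⟨a, b, hab⟩ := exists_kerRow_of_mem z 1 0
  -- `(1, 0)` spans the eigenspace of `σ₁` for the eigenvalue `-t`.
  have hb : b = 0 := by
    have h := hcomm 0 (kerRow 1 0)
    rw [kerRow_sigma0, hab, kerRow_sigma0] at h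
    have e : kerRow (1000 * (0 - 1)) 0 = (-1000 : ℚ) • kerRow 1 0 := by
      rw [← kerRow_smul]; congr 1 <;> norm_num
    rw [e, Matrix.smul_vecMul, hab, ← kerRow_smul] at h
    have := (kerRow_inj h).2
    linarith
  subst hb
  -- `σ₂` maps `(1, 0)` to `(1, 1)`.
  have h11 : kerRow 1 1 ᵥ* (spec z.1).val = kerRow a a := by
    have h := hcomm 1 (kerRow 1 0)
    rw [kerRow_sigma1, hab, kerRow_sigma1] at h
    simpa using h
  refine ⟨a, ?_, fun p q => ?_⟩
  · rintro rfl
    have h := vecMul_inv_of_eq hab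
    have e : kerRow 0 0 = 0 := by funext i; fin_cases i <;> simp [kerRow]
    rw [e, Matrix.zero_vecMul, ← e] at h
    exact zero_ne_one (kerRow_inj h).1
  · have e : kerRow p q = (p - q) • kerRow 1 0 + q • kerRow 1 1 := by
      rw [← kerRow_smul, ← kerRow_smul, ← kerRow_add]; congr 1 <;> ring
    rw [e, Matrix.add_vecMul, Matrix.smul_vecMul, Matrix.smul_vecMul, hab, h11, ← kerRow_smul,
      ← kerRow_smul, ← kerRow_smul, ← kerRow_smul, ← kerRow_add, ← kerRow_add, ← kerRow_smul]
    congr 1 <;> ring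

theorem q_exotic_pow_notMem (n : ℕ) : q (exoticGam ^ (n + 1)) ∉ (q.comp betaGam).range := by
  rintro ⟨b, hb⟩
  obtain ⟨z, hz, h⟩ := (QuotientGroup.mk'_eq_mk' _).1 hb.symm
  obtain ⟨c, hc, hcz⟩ := kerRow_center hz
  obtain ⟨p, q, hpq, hp, hs⟩ := kerRow_exotic_pow n
  obtain ⟨p', q', ho, hb'⟩ := exists_orb_beta b
  have h' : exoticUnit ^ (n + 1) * z.1 = beta b := congrArg Subtype.val h
  rw [← h', map_mul, Units.val_mul, ← Matrix.vecMul_vecMul, hpq, hcz, ← kerRow_smul] at hb'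
  obtain ⟨rfl, rfl⟩ := kerRow_inj hb'
  have hbound := ho.bound
  rw [← mul_add, abs_mul, abs_mul, abs_of_pos (by linarith : 0 < p)] at hbound
  have : p ≤ 2 * |p + q| := le_of_mul_le_mul_left (by linarith) (abs_pos.2 hc)
  linarith

end Burau

theorem theorem1p1 :
    ¬ Function.Surjective (Burau.q.comp Burau.betaGam) ∧
    Infinite (Burau.GamBar ⧸ (Burau.q.comp Burau.betaGam).range) := by
  refine ⟨fun h => Burau.q_exotic_pow_notMem 0 (h _), ?_⟩
  refine Infinite.of_injective (fun n : ℕ => QuotientGroup.mk (Burau.q (Burau.exoticGam ^ n))) ?_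
  refine Function.Injective.of_lt_imp_ne fun m n hmn h => ?_
  obtain ⟨k, rfl⟩ := Nat.exists_eq_add_of_lt hmn
  rw [QuotientGroup.eq, ← map_inv, ← map_mul, add_assoc, pow_add, inv_mul_cancel_left] at h
  exact Burau.q_exotic_pow_notMem k h
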